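/- Let $p$ be a prime, $n\ge 1$, $q=p^n$, and let $f:\mathbb F_q^*\to\mathbb F_p$. Call a function $g:\mathbb F_q^*\to\mathbb F_p$ balanced if it takes the value $0$ exactly $p^{n-1}-1$ times and every nonzero value exactly $p^{n-1}$ times, and call $f$ difference balanced if $x\mapsto f(ax)-f(x)$ is balanced for every $a\in\mathbb F_q^*\setminus\{1\}$. (1) For every primitive element $\theta$ of $\mathbb F_q$ and every primitive $p$-th root of unity $\zeta\in\mathbb C$, $f$ is difference balanced if and only if the sequence $s_i=f(\theta^i)$ has ideal two-level autocorrelation, that is, $\sum_{0\le i<p^n-1}\zeta^{s_{i+\tau}-s_i}$ equals $p^n-1$ if $(p^n-1)\mid\tau$ and $-1$ otherwise. (2) Let $f$ be difference balanced. Then there is exactly one $c\in\mathbb F_p$ such that $f-c$ is balanced. If $f$ is normalized so that it has exactly $p^{n-1}-1$ zeros (that is, $c=0$), then the following hold. (a) $f$ is two-tuple balanced: with $N_{b_1,b_2}(a)=|\{x\in\mathbb F_q^*:(f(x),f(ax))=(b_1,b_2)\}|$, for $a\in\mathbb F_q^*\setminus\mathbb F_p^*$ one has $N_{0,0}(a)=p^{n-2}-1$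 and $N_{b_1,b_2}(a)=p^{n-2}$ for $(b_1,b_2)\ne(0,0)$; and for each $a\in\mathbb F_p^*$ there is $\mu\in\mathbb F_p$ with $f(ax)=\mu f(x)$ for all $x$, $N_{0,0}(a)=p^{n-1}-1$, $N_{b,\mu b}(a)=p^{n-1}$ for $b\neq 0$, and $N_{b_1,b_2}(a)=0$ for $b_2\ne\mu b_1$. (b) Put $D_b=\{x\in\mathbb F_q^*:f(x)=b\}$. An $(m,k',k,\lambda_1,\lambda_2)$ divisible difference set in an abelian group $G$ of order $mk'$ with respect to a subgroup $N$ of order $k'$ is a $k$-subset $D$ such that, among the quotients $d_1d_2^{-1}$ of distinct $d_1,d_2\in D$, each non-identity element of $N$ occurs exactly $\lambda_1$ times and each element of $G\setminus N$ exactly $\lambda_2$ times; it is an $(m,k',k,\lambda_2)$ relative difference set if $\lambda_1=0$. A $(v,k,\lambda)$ difference set in a group $G$ of order $v$ is a $k$-subset for which each non-identity element of $G$ occurs exactly $\lambda$ times as such a quotient. Then, in the cyclic group $\mathbb F_q^*$ and with respect to the subgroup $\mathbb F_p^*$, the set $D_b$ is a $\left(\frac{p^n-1}{p-1},p-1,p^{n-1},p^{n-2}\right)$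 relative difference set for each $b\neq 0$, and $D_0$ is a $\left(\frac{p^n-1}{p-1},p-1,p^{n-1}-1,p^{n-1}-1,p^{n-2}-1\right)$ divisible difference set. (c) Let $\rho:\mathbb F_q^*\to\mathbb F_q^*/\mathbb F_p^*$ be the canonical epimorphism onto this cyclic group. For each $b\ne 0$, $\rho(D_b)$ is a difference set with Singer parameters $\left(\frac{p^n-1}{p-1},p^{n-1},p^{n-2}(p-1)\right)$, and $\rho(D_0)$ is the complement of $\rho(D_b)$; it is a difference set with Singer parameters $\left(\frac{p^n-1}{p-1},\frac{p^{n-1}-1}{p-1},\frac{p^{n-2}-1}{p-1}\right)$. (For $n=1$ the conditions that involve $p^{n-2}$ are vacuous.) -/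

import Mathlib

/-- The subgroup `F^*` of `K^*`, for a field extension `K / F`. -/
def baseUnits (F K : Type*) [Field F] [Field K] [Algebra F K] : Subgroup Kˣ :=
  (Units.map (algebraMap F K : F →* K)).range

/-- `f : K^* → F` is balanced, where `|F| = q` and `|K| = q ^ n`. -/
def IsBalanced {F K : Type*} [Field F] [Field K] (q n : ℕ) (f : Kˣ → F) : Prop :=
  {x : Kˣ | f x = 0}.ncard = q ^ (n - 1) - 1 ∧
    ∀ b : F, b ≠ 0 → {x : Kˣ | f x = b}.ncard = q ^ (n - 1)

/-- `f : K^* → F` is difference balanced: `x ↦ f (a x) - f x` is balanced for every `a ≠ 1`. -/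
def IsDifferenceBalanced {F K : Type*} [Field F] [Field K] (q n : ℕ) (f : Kˣ → F) : Prop :=
  ∀ a : Kˣ, a ≠ 1 → IsBalanced q n (fun x => f (a * x) - f x)

/-- The number `N_{b₁,b₂}(a)` of `x ∈ K^*` with `(f x, f (a x)) = (b₁, b₂)`. -/
noncomputable def pairCount {F K : Type*} [Field F] [Field K] (f : Kˣ → F) (a : Kˣ) (b₁ b₂ : F) :
    ℕ :=
  {x : Kˣ | (f x, f (a * x)) = (b₁, b₂)}.ncard

/-- `f : K^* → F` is two-tuple balanced, where `|F| = q` and `|K| = q ^ n`.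
The first part is void for `n = 1`, since then every `a` lies in `F^*`. -/
def IsTwoTupleBalanced {F K : Type*} [Field F] [Field K] [Algebra F K] (q n : ℕ) (f : Kˣ → F) :
    Prop :=
  (∀ a : Kˣ, a ∉ baseUnits F K →
    pairCount f a 0 0 = q ^ (n - 2) - 1 ∧
    ∀ b₁ b₂ : F, (b₁, b₂) ≠ (0, 0) → pairCount f a b₁ b₂ = q ^ (n - 2)) ∧
  (∀ a : Kˣ, a ∈ baseUnits F K → ∃ μ : F,
    (∀ x : Kˣ, f (a * x) = μ * f x) ∧
    pairCount f a 0 0 = q ^ (n - 1) - 1 ∧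
    (∀ b : F, b ≠ 0 → pairCount f a b (μ * b) = q ^ (n - 1)) ∧
    ∀ b₁ b₂ : F, b₂ ≠ μ * b₁ → pairCount f a b₁ b₂ = 0)

/-- The number of times `g` occurs in the list of differences `d₁ d₂⁻¹`, with `d₁ ≠ d₂` in `D`. -/
noncomputable def differenceCount {G : Type*} [CommGroup G] (D : Set G) (g : G) : ℕ :=
  {d : G × G | d.1 ∈ D ∧ d.2 ∈ D ∧ d.1 ≠ d.2 ∧ d.1 * d.2⁻¹ = g}.ncard

/-- `D` is an `(m, n, k, lam₁, lam₂)` divisible difference set in `G` with respect to the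
subgroup `N`: `|G| = m n`, `|N| = n`, `|D| = k`, every non-identity element of `N` occurs `lam₁`
times as a difference and every element outside `N` occurs `lam₂` times. -/
structure IsDivisibleDifferenceSet {G : Type*} [CommGroup G] (N : Subgroup G)
    (m n k lam₁ lam₂ : ℕ) (D : Set G) : Prop where
  card_group : Nat.card G = m * n
  card_subgroup : Nat.card N = n
  card_set : D.ncard = k
  inside : ∀ g : G, g ∈ N → g ≠ 1 → differenceCount D g = lam₁
  outside : ∀ g : G, g ∉ N → differenceCount D g = lam₂

/-- `D` is an `(m, n, k, lam)` difference set in `G` relative to `N`. -/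
def IsRelativeDifferenceSet {G : Type*} [CommGroup G] (N : Subgroup G)
    (m n k lam : ℕ) (D : Set G) : Prop :=
  IsDivisibleDifferenceSet N m n k 0 lam D

/-- `D` is a `(v, k, lam)` difference set in `G`. -/
structure IsDifferenceSet {G : Type*} [CommGroup G] (v k lam : ℕ) (D : Set G) : Prop where
  card_group : Nat.card G = v
  card_set : D.ncard = k
  count : ∀ g : G, g ≠ 1 → differenceCount D g = lam

/-- The autocorrelation at shift `τ` of a `p`-ary sequence `s` of period `N`, with respect to a
primitive `p`-th root of unity `ζ`. -/
noncomputable def autocorrelation {p : ℕ} (N : ℕ) (ζ : ℂ) (s : ℕ → ZMod p) (τ : ℕ) : ℂ :=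
  ∑ i ∈ Finset.range N, ζ ^ (s (i + τ) - s i).val

/-- The ideal two-level autocorrelation of a `p`-ary sequence of period `N`. -/
def HasIdealAutocorrelation {p : ℕ} (N : ℕ) (ζ : ℂ) (s : ℕ → ZMod p) : Prop :=
  ∀ τ : ℕ, (N ∣ τ → autocorrelation N ζ s τ = N) ∧ (¬ N ∣ τ → autocorrelation N ζ s τ = -1)

/-! Write `q = p ^ n`, `G = Kˣ`, `π = ζ - 1`. The heart of the matter is homogeneity: for a
normalized difference balanced `f`, the elements of the prime field act on `f` by scalars.
Everything else is counting.

In `ℤ[ζ][G]` put `u = ∑ ζ ^ (-f y) y⁻¹` and `v = ∑ (ζ ^ f x - 1) x`. Difference balance says `u v =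
q`, and `q` is a unit times a power of `π`. As `|G| = q - 1`, every element satisfies `x ^ q ≡ x`
modulo `π`. This makes `ζ ↦ ζ ^ t` a multiplier: applied to `u` alone it keeps the power of `π`
dividing `u v` (`pow_dvd_map_mul_of_pow_dvd_mul`). Hence `q` divides `∑ ζ ^ (f (a y) - t f y) + 1`
for all `a` and all `t ≠ 0` (`dvd_sum_char_sub_mul_add_one`).

Such a divisibility makes the fiber sizes of `f (a y) - t f y`, with one added at `0`, congruent
modulo `q`. Their sum is `q`, so the function is balanced or identically zero
(`hasBalancedFibers_or_eq_zero`). For fixed `t`, a double count shows that balance cannot hold for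
every `a`, so `f (a x) = t f x` for some `a` (`exists_forall_eq_mul`). Such an `a` satisfies `a ^ (p
- 1) = 1`, so it is a scalar, and all scalars arise this way. For `a` outside the prime field, all
`f (a x) - t f x` are balanced, and counting on the lines of the affine plane gives the joint
distribution (`ncard_pair_fiber`). The difference sets are read off from it. -/

open Polynomial

/-- Let `π` be a nonzerodivisor of `A` such that `x ^ q = x` in `A / π`, and let `σ` be an
endomorphism of `A` that induces the identity on `A / π`. Then `σ` preserves the power of `π`
in a factorization. -/
theorem pow_dvd_map_mul_of_pow_dvd_mul {A : Type*} [CommRing A] {π : A}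
    (hπ : IsLeftRegular π) {q : ℕ} (hq : 2 ≤ q) (hfrob : ∀ x : A, π ∣ x ^ q - x)
    (σ : A →+* A) (hσ : ∀ x : A, π ∣ σ x - x) (m : ℕ) :
    ∀ u v : A, π ^ m ∣ u * v → π ^ m ∣ σ u * v := by
  induction m with
  | zero => intro u v _; simp
  | succ m ih =>
    intro u v huv
    -- Now `u ^ (q - 1) = u ^ (k + 1)` still contains a factor `u`, so `u ^ (q - 1) * v` is a
    -- multiple of `u * v`.
    obtain ⟨k, rfl⟩ : ∃ k, q = k + 2 := ⟨q - 2, by omega⟩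
    have hσπ : π ∣ σ π := (dvd_sub_left (dvd_refl π)).1 (hσ π)
    have hev : π ∣ u ^ (k + 1) * v := by
      have h : u ^ (k + 1) * v = u ^ k * (u * v) := by ring
      rw [h]
      exact ((dvd_pow_self π m.succ_ne_zero).trans huv).mul_left _
    obtain ⟨v', hv'⟩ := hev
    obtain ⟨u', hu'⟩ := hfrob u
    have cancel : ∀ x, π ^ (m + 1) ∣ π * x → π ^ m ∣ x := by
      rintro x ⟨y, hy⟩
      refine ⟨y, hπ ?_⟩
      change π * x = π * (π ^ m * y)
      rw [hy, pow_succ']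
      ring
    -- Both this step and the next divide out one `π`, apply the induction hypothesis to a new pair,
    -- `(u, v')` here and `(u', v)` there, and restore the factor as `π` or `σ π`.
    have h₁ : π ^ (m + 1) ∣ σ u * (u ^ (k + 1) * v) := by
      have h := ih u v' (cancel _ (by
        have h : π * (u * v') = u ^ (k + 1) * (u * v) := by
          linear_combination (-u) * hv'
        rw [h]
        exact huv.mul_left _))
      rw [hv', pow_succ']
      have h' : σ u * (π * v') = π * (σ u * v') := by ring
      rw [h']
      exact mul_dvd_mul_left _ h
    have h₂ : π ^ (m + 1) ∣ (σ u ^ (k + 2) - σ u) * v := by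
      have h := ih u' v (cancel _ (by
        have h : π * (u' * v) = (u ^ (k + 1) - 1) * (u * v) := by
          linear_combination (-v) * hu'
        rw [h]
        exact huv.mul_left _))
      have h' : (σ u ^ (k + 2) - σ u) * v = σ π * (σ u' * v) := by
        have := congrArg σ hu'
        rw [map_sub, map_pow, map_mul] at this
        rw [this, mul_assoc]
      rw [h', pow_succ']
      exact mul_dvd_mul hσπ h
    obtain ⟨r, hr⟩ := hσ (u ^ (k + 1))
    rw [map_pow] at hr
    -- Since `σ` is trivial modulo `π`, the terms in `u ^ (q - 1)` and `σ u ^ (q - 1)` cancel up to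
    -- a multiple of `π`; what is left is `σ u * v` times a unit modulo `π`.
    have h₃ : π ^ (m + 1) ∣ (1 - π * r) * (σ u * v) := by
      have h : (1 - π * r) * (σ u * v) =
          σ u * (u ^ (k + 1) * v) - (σ u ^ (k + 2) - σ u) * v := by
        linear_combination (σ u * v) * hr
      rw [h]
      exact dvd_sub h₁ h₂
    have h₄ : IsCoprime (π ^ (m + 1)) (1 - π * r) :=
      IsCoprime.pow_left ⟨r, 1, by ring⟩
    exact h₄.dvd_of_dvd_mul_left h₃

/-! ### The ring `ℤ[ζ_p]` and the prime `ζ - 1` -/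

/-- If the `p`-th cyclotomic polynomial divides a polynomial of degree less than `p`, then all
coefficients of the latter agree. -/
theorem eq_of_cyclotomic_dvd_sum {R : Type*} [CommRing R] (p : ℕ) [hp : Fact p.Prime]
    (c : ZMod p → R)
    (h : cyclotomic p R ∣ ∑ b : ZMod p, C (c b) * X ^ b.val) (b b' : ZMod p) : c b = c b' := by
  nontriviality R
  have hp0 := hp.out.pos
  obtain ⟨g, hg⟩ := h
  have hmon := cyclotomic.monic p R
  have hdeg : (∑ b : ZMod p, C (c b) * X ^ b.val).natDegree ≤ p - 1 := by
    refine natDegree_sum_le_of_forall_le _ _ fun b _ => ?_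
    exact (natDegree_C_mul_X_pow_le _ _).trans (Nat.le_pred_of_lt (ZMod.val_lt b))
  have hg0 : g.natDegree = 0 := by
    by_cases h0 : g = 0
    · simp [h0]
    · rw [hg, hmon.natDegree_mul' h0, natDegree_cyclotomic, Nat.totient_prime hp.out] at hdeg
      omega
  rw [eq_C_of_natDegree_eq_zero hg0] at hg
  have key : ∀ b : ZMod p, c b = g.coeff 0 := by
    intro b
    have h := congrArg (fun P => coeff P b.val) hg
    simp only [finsetSum_coeff, coeff_C_mul, coeff_X_pow, coeff_mul_C, cyclotomic_prime] at h
    rw [Finset.sum_eq_single b, Finset.sum_eq_single b.val] at h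
    · simpa using h
    · intro i _ hi; simp [hi.symm]
    · intro hb; exact absurd (Finset.mem_range.2 (ZMod.val_lt b)) hb
    · intro b' _ hb
      rw [if_neg, mul_zero]
      exact fun h => hb (ZMod.val_injective p h).symm
    · simp
  rw [key, key]

/-- The ring `ℤ[ζ_p]`. -/
abbrev CyclotomicInt (p : ℕ) : Type := AdjoinRoot (cyclotomic p ℤ)

namespace CyclotomicInt

/-- The distinguished `p`-th root of unity. -/
noncomputable abbrev zeta (p : ℕ) : CyclotomicInt p := AdjoinRoot.root (cyclotomic p ℤ)

theorem mk_eq_eval_map (p : ℕ) (P : ℤ[X]) : AdjoinRoot.mk (cyclotomic p ℤ) P =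
    (P.map (Int.castRingHom (CyclotomicInt p))).eval (zeta p) := by
  rw [eval_map, ← coe_eval₂RingHom]
  refine congrFun (congrArg DFunLike.coe (Polynomial.ringHom_ext' (Subsingleton.elim _ _) ?_)) P
  simp

variable (p : ℕ) [hp : Fact p.Prime]

instance : IsDomain (CyclotomicInt p) :=
  AdjoinRoot.isDomain_of_prime (cyclotomic.irreducible hp.out.pos).prime

instance : CharZero (CyclotomicInt p) := by
  refine charZero_of_injective_algebraMap (R := ℤ) ?_
  refine AdjoinRoot.of.injective_of_degree_ne_zero ?_
  rw [degree_cyclotomic, Nat.totient_prime hp.out]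
  have := hp.out.two_le
  exact_mod_cast (by omega : p - 1 ≠ 0)

theorem isPrimitiveRoot_zeta : IsPrimitiveRoot (zeta p) p := by
  have : NeZero ((p : ℕ) : CyclotomicInt p) := ⟨Nat.cast_ne_zero.2 hp.out.ne_zero⟩
  rw [← isRoot_cyclotomic_iff, IsRoot, ← map_cyclotomic_int p (CyclotomicInt p), eval_map]
  rw [Subsingleton.elim (Int.castRingHom (CyclotomicInt p)) (AdjoinRoot.of _)]
  exact AdjoinRoot.eval₂_root (cyclotomic p ℤ)

/-- The additive character `b ↦ ζ ^ b`. -/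
noncomputable def char : AddChar (ZMod p) (CyclotomicInt p) :=
  AddChar.zmodChar p (isPrimitiveRoot_zeta p).pow_eq_one

theorem char_apply (b : ZMod p) : char p b = zeta p ^ b.val := AddChar.zmodChar_apply _ _

theorem zeta_sub_one_ne_zero : zeta p - 1 ≠ 0 :=
  sub_ne_zero.2 ((isPrimitiveRoot_zeta p).ne_one hp.out.one_lt)

/-- `p` and `(ζ - 1) ^ (p - 1)` are associated. -/
theorem associated_zeta_sub_one_pow :
    Associated ((zeta p - 1) ^ (p - 1)) (p : CyclotomicInt p) := by
  have hζ : IsPrimitiveRoot (zeta p) (p - 1 + 1) := by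
    rw [Nat.sub_add_cancel hp.out.one_le]
    exact isPrimitiveRoot_zeta p
  have h := hζ.prod_one_sub_pow_eq_order
  rw [← Nat.cast_add_one, Nat.sub_add_cancel hp.out.one_le] at h
  have h' : ∏ _k ∈ Finset.range (p - 1), (zeta p - 1) = (zeta p - 1) ^ (p - 1) := by
    rw [Finset.prod_const, Finset.card_range]
  rw [← h, ← h']
  refine Associated.prod _ _ _ fun k hk => ?_
  rw [← neg_sub _ (1 : CyclotomicInt p), Associated.neg_right_iff]
  refine (isPrimitiveRoot_zeta p).associated_sub_one_pow_sub_one_of_coprime ?_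
  rw [Nat.coprime_comm, hp.out.coprime_iff_not_dvd]
  intro hd
  have := Nat.le_of_dvd k.succ_pos hd
  have := Finset.mem_range.1 hk
  omega

variable {p}

theorem zeta_sub_one_dvd_prime : zeta p - 1 ∣ (p : CyclotomicInt p) :=
  (dvd_pow_self _ (by have := hp.out.two_le; omega)).trans
    (associated_zeta_sub_one_pow p).dvd

/-- Modulo `ζ - 1` every `P(ζ)` becomes the integer `P(1)`, and `p` becomes `0`; so Fermat's little
theorem applies. -/
theorem zeta_sub_one_dvd_pow_sub_self (k : ℕ) (x : CyclotomicInt p) :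
    zeta p - 1 ∣ x ^ p ^ k - x := by
  induction x using AdjoinRoot.induction_on with
  | ih P =>
    have h₁ : zeta p - 1 ∣ AdjoinRoot.mk (cyclotomic p ℤ) P - ((P.eval 1 : ℤ) : CyclotomicInt p) := by
      have h := sub_dvd_eval_sub (zeta p) 1 (P.map (Int.castRingHom (CyclotomicInt p)))
      rw [eval_one_map, ← mk_eq_eval_map] at h
      exact h
    have h₂ : zeta p - 1 ∣ ((P.eval 1 : ℤ) : CyclotomicInt p) ^ p ^ k - ((P.eval 1 : ℤ) :
        CyclotomicInt p) := by
      refine zeta_sub_one_dvd_prime.trans ?_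
      have h : (p : ℤ) ∣ (P.eval 1) ^ p ^ k - P.eval 1 := by
        rw [← ZMod.intCast_zmod_eq_zero_iff_dvd]
        push_cast
        rw [ZMod.pow_card_pow, sub_self]
      exact_mod_cast map_dvd (Int.castRingHom (CyclotomicInt p)) h
    have h₃ := h₁.trans (sub_dvd_pow_sub_pow _ _ (p ^ k))
    have h := dvd_sub (dvd_add h₃ h₂) h₁
    convert h using 1
    ring

/-- The endomorphism of `ℤ[ζ_p]` with `ζ ↦ ζ ^ t`. -/
noncomputable def galois (t : ZMod p) (ht : t ≠ 0) : CyclotomicInt p →+* CyclotomicInt p :=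
  AdjoinRoot.lift (Int.castRingHom _) (zeta p ^ t.val) (by
    have h : IsPrimitiveRoot (zeta p ^ t.val) p := by
      refine (isPrimitiveRoot_zeta p).pow_of_coprime _ ?_
      rw [Nat.coprime_comm, hp.out.coprime_iff_not_dvd]
      intro hd
      have := Nat.le_of_dvd (ZMod.val_pos.2 ht) hd
      have := ZMod.val_lt t
      omega
    have h' := h.isRoot_cyclotomic hp.out.pos
    rwa [IsRoot, ← map_cyclotomic_int p (CyclotomicInt p), eval_map] at h')

theorem galois_char (t : ZMod p) (ht : t ≠ 0) (b : ZMod p) :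
    galois t ht (char p b) = char p (t * b) := by
  have h : char p (t * b) = char p t ^ b.val := by
    rw [← AddChar.map_nsmul_eq_pow, nsmul_eq_mul, ZMod.natCast_zmod_val, mul_comm]
  rw [h, char_apply, char_apply, map_pow, galois, AdjoinRoot.lift_root]

theorem zeta_sub_one_dvd_galois_sub_self (t : ZMod p) (ht : t ≠ 0) (x : CyclotomicInt p) :
    zeta p - 1 ∣ galois t ht x - x := by
  induction x using AdjoinRoot.induction_on with
  | ih P =>
    have h := sub_dvd_eval_sub (zeta p ^ t.val) (zeta p) (P.map (Int.castRingHom (CyclotomicInt p)))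
    rw [← mk_eq_eval_map, eval_map] at h
    rw [galois, AdjoinRoot.lift_mk]
    refine dvd_trans ?_ h
    have h1 : zeta p - 1 ∣ zeta p ^ t.val - 1 := by
      simpa using sub_dvd_pow_sub_pow (zeta p) 1 t.val
    convert dvd_sub h1 (dvd_refl _) using 1
    ring

/-- The only linear relations among `1, ζ, …, ζ ^ (p - 1)` are the multiples of `1 + ζ + ⋯ + ζ ^ (p
- 1) = 0`. This persists modulo `N` because the cyclotomic polynomial is monic. -/
theorem dvd_sub_of_dvd_sum_char (N : ℕ) (c : ZMod p → ℤ)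
    (h : (N : CyclotomicInt p) ∣ ∑ b, (c b : CyclotomicInt p) * char p b) (b b' : ZMod p) :
    (N : ℤ) ∣ c b - c b' := by
  obtain ⟨y, hy⟩ := h
  obtain ⟨Q, rfl⟩ := AdjoinRoot.mk_surjective y
  have h1 : AdjoinRoot.mk (cyclotomic p ℤ) (∑ b, C (c b) * X ^ b.val) =
      AdjoinRoot.mk (cyclotomic p ℤ) (C (N : ℤ) * Q) := by
    rw [map_sum, map_mul]
    simp only [map_mul, map_pow, AdjoinRoot.mk_X, ← char_apply, AdjoinRoot.mk_C]
    simpa using hy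
  have h2 := AdjoinRoot.mk_eq_mk.1 h1
  have h3 := Polynomial.map_dvd (Int.castRingHom (ZMod N)) h2
  rw [map_cyclotomic, Polynomial.map_sub, Polynomial.map_mul, map_C, Polynomial.map_sum] at h3
  simp only [Polynomial.map_mul, map_C, Polynomial.map_pow, map_X] at h3
  simp only [eq_intCast, Int.cast_natCast, CharP.cast_eq_zero, map_zero, zero_mul, sub_zero] at h3
  have h4 := eq_of_cyclotomic_dvd_sum p (fun b => (c b : ZMod N)) h3 b b'
  rw [← ZMod.intCast_zmod_eq_zero_iff_dvd, Int.cast_sub, sub_eq_zero]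
  exact h4

end CyclotomicInt

/-! ### Balanced fibers and character sums -/

/-- Adding one to the number of zeros of `g`, all fibers of `g` have `P` elements. -/
def HasBalancedFibers {X F : Type*} [DecidableEq F] [Zero F] (P : ℕ) (g : X → F) : Prop :=
  ∀ b : F, {x | g x = b}.ncard + (if b = 0 then 1 else 0) = P

theorem isBalanced_iff_hasBalancedFibers {F K : Type*} [DecidableEq F] [Field F] [Field K] {q n : ℕ} (hq : 0 < q)
    (f : Kˣ → F) : IsBalanced q n f ↔ HasBalancedFibers (q ^ (n - 1)) f := by
  have hP : 0 < q ^ (n - 1) := pow_pos hq _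
  constructor
  · rintro ⟨h₀, h⟩ b
    by_cases hb : b = 0
    · subst hb
      rw [h₀, if_pos rfl]
      omega
    · rw [if_neg hb, h b hb, add_zero]
  · intro h
    refine ⟨?_, fun b hb => ?_⟩
    · have := h 0
      rw [if_pos rfl] at this
      omega
    · have := h b
      rwa [if_neg hb] at this

section Fibers

theorem HasBalancedFibers.const_mul {X F : Type*} [DecidableEq F] [Field F] {P : ℕ} {g : X → F}
    (hg : HasBalancedFibers P g) {c : F} (hc : c ≠ 0) : HasBalancedFibers P fun x => c * g x := by
  intro b
  have h := hg (c⁻¹ * b)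
  have h' : {x | c * g x = b} = {x | g x = c⁻¹ * b} := by
    ext x
    simp only [Set.mem_ofPred_eq]
    rw [eq_inv_mul_iff_mul_eq₀ hc]
  have h₀ : c⁻¹ * b = 0 ↔ b = 0 := by simp [hc]
  simpa only [h', h₀] using h

variable {X F : Type*} [Fintype X]

theorem sum_comp_eq_sum_ncard_mul [Fintype F] {R : Type*} [CommRing R] (φ : F → R)
    (g : X → F) : ∑ x, φ (g x) = ∑ b, (({x | g x = b}.ncard : ℤ) : R) * φ b := by
  classical
  rw [← Finset.sum_fiberwise Finset.univ g]
  refine Finset.sum_congr rfl fun b _ => ?_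
  rw [Finset.sum_congr rfl (g := fun _ => φ b) (by intro x hx; rw [(Finset.mem_filter.1 hx).2]),
    Finset.sum_const, nsmul_eq_mul, Set.ncard_eq_toFinset_card', Set.toFinset_ofPred, Int.cast_natCast]

theorem sum_ncard_fiber [Fintype F] (g : X → F) :
    ∑ b, {x | g x = b}.ncard = Nat.card X := by
  have h := sum_comp_eq_sum_ncard_mul (R := ℤ) (fun _ => 1) g
  simp only [Finset.sum_const, Finset.card_univ, mul_one, Int.cast_id, nsmul_eq_mul] at h
  rw [Nat.card_eq_fintype_card]
  exact_mod_cast h.symm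

/-- The added one is the contribution of an imaginary extra point with value `0`, which makes the
fibers of a balanced function equal in size. -/
theorem sum_fiber_add_one_mul [Fintype F] [DecidableEq F] [Zero F] {R : Type*} [CommRing R] (φ : F → R)
    (h₀ : φ 0 = 1) (g : X → F) : ∑ x, φ (g x) + 1 =
      ∑ b, ((({x | g x = b}.ncard + if b = 0 then 1 else 0 : ℕ) : ℤ) : R) * φ b := by
  rw [sum_comp_eq_sum_ncard_mul]
  simp [add_mul, Finset.sum_add_distrib, h₀]

theorem sum_fiber_add_one [Fintype F] [DecidableEq F] [Zero F] (g : X → F) :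
    ∑ b, ({x | g x = b}.ncard + if b = 0 then 1 else 0) = Nat.card X + 1 := by
  rw [Finset.sum_add_distrib, sum_ncard_fiber]
  simp

theorem HasBalancedFibers.sum_addChar [Fintype F] [DecidableEq F] [AddGroup F] {R : Type*} [CommRing R]
    [IsDomain R] {e : AddChar F R} (he : e ≠ 1) {P : ℕ} {g : X → F} (hg : HasBalancedFibers P g) :
    ∑ x, e (g x) = -1 := by
  classical
  have h := sum_fiber_add_one_mul e e.map_zero_eq_one g
  simp only [hg _, ← Finset.mul_sum, AddChar.sum_eq_zero_of_ne_one he, mul_zero] at h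
  exact eq_neg_of_add_eq_zero_left h

end Fibers

/-! ### Balance from character sums -/

section Dichotomy

variable {p : ℕ} [hp : Fact p.Prime] {X : Type*} [Fintype X]

theorem hasBalancedFibers_of_forall_eq {P : ℕ} (hX : Nat.card X + 1 = p * P) {g : X → ZMod p}
    (h : ∀ b, {x | g x = b}.ncard + (if b = 0 then 1 else 0) =
      {x | g x = 0}.ncard + 1) : HasBalancedFibers P g := by
  have hs := sum_fiber_add_one g
  simp only [h, Finset.sum_const, Finset.card_univ, ZMod.card, smul_eq_mul, hX] at hs
  intro b
  rw [h, Nat.eq_of_mul_eq_mul_left hp.out.pos hs]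

theorem hasBalancedFibers_or_eq_zero {P : ℕ} (hX : Nat.card X + 1 = p * P)
    {g : X → ZMod p}
    (h : ((p * P : ℕ) : CyclotomicInt p) ∣ ∑ x, CyclotomicInt.char p (g x) + 1) :
    HasBalancedFibers P g ∨ ∀ x, g x = 0 := by
  by_cases hb : ∀ b, {x | g x = b}.ncard + (if b = 0 then 1 else 0) = {x | g x = 0}.ncard + 1
  · exact Or.inl (hasBalancedFibers_of_forall_eq hX hb)
  right
  push Not at hb
  obtain ⟨b, hb⟩ := hb
  have hb0 : b ≠ 0 := by
    rintro rfl
    simp at hb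
  rw [if_neg hb0, add_zero] at hb
  rw [sum_fiber_add_one_mul _ (AddChar.map_zero_eq_one _)] at h
  have hd := CyclotomicInt.dvd_sub_of_dvd_sum_char _ _ h b 0
  simp only [if_neg hb0, if_true, add_zero] at hd
  have hle : {x | g x = b}.ncard + {x | g x = 0}.ncard ≤ Nat.card X := by
    rw [← sum_ncard_fiber g]
    have := Finset.sum_le_sum_of_subset (f := fun b => {x | g x = b}.ncard)
      (Finset.subset_univ {b, 0})
    rwa [Finset.sum_pair hb0] at this
  -- Two unequal nonnegative counts congruent modulo `p * P` force the larger to be at least `p *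
  -- P`. As there are only `p * P - 1` points, it must be the count at `0`, and its fiber is
  -- everything.
  have hge : p * P ≤ {x | g x = b}.ncard ∨ p * P ≤ {x | g x = 0}.ncard + 1 := by
    rcases lt_or_gt_of_ne hb with hlt | hlt
    · right
      rw [← dvd_neg, neg_sub] at hd
      have := Int.le_of_dvd (by push_cast; omega) hd
      omega
    · left
      have := Int.le_of_dvd (by push_cast; omega) hd
      omega
  have hfull : {x | g x = 0} = Set.univ := by
    apply Set.eq_of_subset_of_ncard_le (Set.subset_univ _)
    rw [Set.ncard_univ]
    omega
  intro x
  have : x ∈ {x | g x = 0} := hfull ▸ Set.mem_univ x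
  exact this

/-- For the converse, the corrected fiber sizes are the coefficients of a polynomial of degree below
`p` vanishing at `ζ`, hence divisible by the minimal polynomial of `ζ`, which is cyclotomic. -/
theorem hasBalancedFibers_iff_sum_pow {P : ℕ} (hX : Nat.card X + 1 = p * P)
    {ζ : ℂ} (hζ : IsPrimitiveRoot ζ p) (g : X → ZMod p) :
    HasBalancedFibers P g ↔ ∑ x, ζ ^ (g x).val = -1 := by
  have he : ∀ b, AddChar.zmodChar p hζ.pow_eq_one b = ζ ^ b.val := fun b =>
    AddChar.zmodChar_apply _ _
  simp only [← he]
  constructor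
  · intro h
    refine h.sum_addChar ?_
    intro h1
    have := DFunLike.congr_fun h1 1
    rw [he, ZMod.val_one, pow_one, AddChar.one_apply] at this
    exact hζ.ne_one hp.out.one_lt this
  · intro h
    have h' := sum_fiber_add_one_mul _ (AddChar.map_zero_eq_one
      (AddChar.zmodChar p hζ.pow_eq_one)) g
    rw [h, neg_add_cancel] at h'
    refine hasBalancedFibers_of_forall_eq hX fun b => ?_
    have hd : cyclotomic p ℤ ∣ ∑ b : ZMod p,
        C (({x | g x = b}.ncard + if b = 0 then 1 else 0 : ℕ) : ℤ) * Polynomial.X ^ b.val := by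
      rw [cyclotomic_eq_minpoly hζ hp.out.pos]
      refine minpoly.isIntegrallyClosed_dvd (hζ.isIntegral hp.out.pos) ?_
      rw [h', map_sum]
      refine Finset.sum_congr rfl fun b _ => ?_
      rw [map_mul, map_pow, aeval_X, aeval_C, he]
      simp
    have := eq_of_cyclotomic_dvd_sum p _ hd b 0
    rw [if_pos rfl] at this
    exact_mod_cast this

end Dichotomy

/-! ### Correlations and Frobenius in the group algebra -/

section GroupAlgebra

open MonoidAlgebra

theorem coeff_sum_single {G R : Type*} [Fintype G] [CommRing R] (γ : G → R) (a : G) : (∑ x, single x (γ x)).coeff a = γ a := by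
  classical
  simp [coeff_single, Finsupp.single_apply]

theorem isLeftRegular_single_one {G R : Type*} [CommGroup G] [CommRing R] [IsDomain R] {c : R} (hc : c ≠ 0) :
    IsLeftRegular (single 1 c : MonoidAlgebra R G) := by
  intro x y h
  ext a
  have h := congrArg (fun z : MonoidAlgebra R G => z.coeff a) h
  simp only [coeff_single_one_mul] at h
  exact mul_left_cancel₀ hc h

variable {G : Type*} [CommGroup G] [Fintype G] {R : Type*} [CommRing R]

theorem sum_single_mul_sum_single_inv (α β : G → R) :
    (∑ x, single x (α x)) * (∑ y, single y⁻¹ (β y)) = ∑ a, single a (∑ y, α (a * y) * β y) := by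
  have h : ∀ y : G, ∑ x, single (x * y⁻¹) (α x * β y) = ∑ a, single a (α (a * y) * β y) := by
    intro y
    rw [← Equiv.sum_comp (Equiv.mulRight y)]
    simp
  rw [Finset.sum_mul_sum, Finset.sum_comm]
  simp only [single_mul_single, h]
  rw [Finset.sum_comm]
  refine Finset.sum_congr rfl fun a _ => ?_
  exact (map_sum (singleAddHom a) _ _).symm

theorem single_one_dvd_iff (c : R) (x : MonoidAlgebra R G) :
    single 1 c ∣ x ↔ ∀ a, c ∣ x.coeff a := by
  constructor
  · rintro ⟨y, rfl⟩ a
    rw [coeff_single_one_mul]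
    exact dvd_mul_right _ _
  · intro h
    choose y hy using h
    refine ⟨∑ a, single a (y a), ?_⟩
    ext a
    rw [coeff_single_one_mul, coeff_sum_single, hy]

/-- Modulo `c`, which divides `p`, the `p ^ k`-th power is additive. It fixes group elements since
`g ^ |G| = 1`, and coefficients by `hc`. -/
theorem single_one_dvd_pow_sub_self {p k : ℕ} (hp : p.Prime) (hG : Fintype.card G + 1 = p ^ k)
    {c : R} (hcp : c ∣ (p : R)) (hc : ∀ r : R, c ∣ r ^ p ^ k - r) (x : MonoidAlgebra R G) :
    single 1 c ∣ x ^ p ^ k - x := by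
  induction x using MonoidAlgebra.induction_linear with
  | zero => rw [zero_pow (pow_pos hp.pos k).ne', sub_zero]; exact dvd_zero _
  | add x y hx hy =>
    obtain ⟨r, hr⟩ := exists_add_pow_prime_pow_eq hp x y k
    have h : (single 1 c : MonoidAlgebra R G) ∣ (p : MonoidAlgebra R G) := by
      classical
      rw [single_one_dvd_iff]
      intro a
      rw [coeff_natCast, Finsupp.single_apply]
      split_ifs
      exacts [hcp, dvd_zero _]
    have h' : (x + y) ^ p ^ k - (x + y) =
        (x ^ p ^ k - x) + (y ^ p ^ k - y) + p * (x * y * r) := by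
      rw [hr]; ring
    rw [h']
    exact dvd_add (dvd_add hx hy) (h.mul_right _)
  | single g r =>
    rw [single_pow, ← hG, pow_succ g, pow_card_eq_one, one_mul, hG]
    obtain ⟨s, hs⟩ := hc r
    refine ⟨single g s, ?_⟩
    rw [single_mul_single, one_mul, ← hs]
    exact (map_sub (singleAddHom (R := R) g) _ _).symm

end GroupAlgebra

/-! ### The multiplier theorem -/

section Multiplier

open MonoidAlgebra CyclotomicInt

variable {p : ℕ} [hp : Fact p.Prime] {G : Type*} [CommGroup G] [Fintype G]

theorem CyclotomicInt.char_ne_one : CyclotomicInt.char p ≠ 1 := by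
  intro h
  have h := DFunLike.congr_fun h 1
  rw [char_apply, ZMod.val_one, pow_one, AddChar.one_apply] at h
  exact (isPrimitiveRoot_zeta p).ne_one hp.out.one_lt h

/-- The multiplier theorem: for nonzero `t`, the sums `∑ y, ζ ^ (f (a y) - t f y)` are congruent
to `-1` modulo the order of the field. -/
theorem dvd_sum_char_sub_mul_add_one {k : ℕ} (hG : Fintype.card G + 1 = p ^ (k + 1)) {P : ℕ}
    {f : G → ZMod p} (hf : HasBalancedFibers P f)
    (hd : ∀ a : G, a ≠ 1 → HasBalancedFibers P fun x => f (a * x) - f x) {t : ZMod p} (ht : t ≠ 0)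
    (a : G) :
    ((p ^ (k + 1) : ℕ) : CyclotomicInt p) ∣ ∑ y, char p (f (a * y) - t * f y) + 1 := by
  classical
  set u : MonoidAlgebra (CyclotomicInt p) G := ∑ y, single y⁻¹ (char p (-f y)) with hu
  set v : MonoidAlgebra (CyclotomicInt p) G := ∑ x, single x (char p (f x) - 1) with hv
  have hprod : ∀ s : ZMod p, s ≠ 0 → v * ∑ y, single y⁻¹ (char p (-(s * f y))) =
      ∑ a, single a (∑ y, char p (f (a * y) - s * f y) + 1) := by
    intro s hs
    rw [hv, sum_single_mul_sum_single_inv]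
    refine Finset.sum_congr rfl fun a _ => ?_
    congr 1
    simp only [sub_mul, one_mul, ← AddChar.map_add_eq_mul, Finset.sum_sub_distrib, ← sub_eq_add_neg]
    -- The `-1` in the coefficients of `v` contributes minus this sum, that is `+1`, to every
    -- coefficient of the product.
    have := (hf.const_mul (neg_ne_zero.2 hs)).sum_addChar char_ne_one
    simp only [neg_mul] at this
    rw [this, sub_neg_eq_add]
  have hπ := zeta_sub_one_ne_zero p
  have hassoc : Associated ((zeta p - 1) ^ ((p - 1) * (k + 1)))
      ((p ^ (k + 1) : ℕ) : CyclotomicInt p) := by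
    rw [pow_mul, Nat.cast_pow]
    exact (associated_zeta_sub_one_pow p).pow_pow
  have huv : (single 1 (zeta p - 1) : MonoidAlgebra (CyclotomicInt p) G) ^ ((p - 1) * (k + 1)) ∣
      u * v := by
    have h := hprod 1 one_ne_zero
    simp only [one_mul] at h
    rw [mul_comm u v, hu, h, single_pow, one_pow, single_one_dvd_iff]
    intro a
    rw [coeff_sum_single]
    -- The coefficient at `1` is `|G| + 1`, the field order; all others vanish by difference
    -- balance.
    by_cases ha : a = 1
    · subst ha
      simp only [one_mul, sub_self, AddChar.map_zero_eq_one, Finset.sum_const, Finset.card_univ,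
        nsmul_eq_mul, mul_one]
      rw [← Nat.cast_add_one, hG]
      exact hassoc.dvd
    · rw [(hd a ha).sum_addChar char_ne_one, neg_add_cancel]
      exact dvd_zero _
  have hfrob := single_one_dvd_pow_sub_self (G := G) (c := zeta p - 1) hp.out hG
    zeta_sub_one_dvd_prime (zeta_sub_one_dvd_pow_sub_self (k + 1))
  have hσ : ∀ x : MonoidAlgebra (CyclotomicInt p) G,
      single 1 (zeta p - 1) ∣ mapRingHom G (galois t ht) x - x := by
    intro x
    rw [single_one_dvd_iff]
    intro a
    have := zeta_sub_one_dvd_galois_sub_self t ht (x.coeff a)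
    simpa using this
  have hq : 2 ≤ p ^ (k + 1) := hp.out.two_le.trans (Nat.le_self_pow k.succ_ne_zero p)
  have key := pow_dvd_map_mul_of_pow_dvd_mul (isLeftRegular_single_one hπ) hq hfrob _ hσ _ _ _ huv
  rw [hu, map_sum] at key
  simp only [mapRingHom_single, galois_char, mul_neg] at key
  rw [mul_comm _ v, hprod t ht, single_pow, one_pow, single_one_dvd_iff] at key
  have := key a
  rw [coeff_sum_single] at this
  exact hassoc.symm.dvd.trans this

end Multiplier

/-! ### Double counting -/

section Counting

theorem ncard_setOf_eq_sum_ite {X : Type*} [Fintype X] (r : X → Prop) [DecidablePred r] :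
    {x | r x}.ncard = ∑ x, if r x then 1 else 0 := by
  rw [Set.ncard_eq_toFinset_card', Set.toFinset_ofPred, Finset.card_filter]

variable {p : ℕ} [hp : Fact p.Prime]

/-- Both sides count the pairs `(x, y)` with `α x = β y`; on the right they are sorted by the
quotient `a = x y⁻¹`. -/
theorem sum_ncard_fiber_eq_sum_ncard_coincidence {G F : Type*} [Group G] [Fintype G]
    [DecidableEq F] (α β : G → F) :
    ∑ y, {x | α x = β y}.ncard = ∑ a : G, {y | α (a * y) = β y}.ncard := by
  simp only [ncard_setOf_eq_sum_ite]
  rw [Finset.sum_comm (γ := G)]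
  conv_rhs => rw [Finset.sum_comm]
  rw [Finset.sum_comm]
  refine Finset.sum_congr rfl fun y _ => ?_
  exact (Equiv.sum_comp (Equiv.mulRight y) fun x => if α x = β y then 1 else 0).symm

theorem HasBalancedFibers.comp_equiv {X Y F : Type*} [Zero F] [DecidableEq F] {P : ℕ} {g : X → F}
    (hg : HasBalancedFibers P g) (e : Y ≃ X) : HasBalancedFibers P fun y => g (e y) := by
  intro b
  rw [← hg b]
  congr 1
  have h : {y | g (e y) = b} = e ⁻¹' {x | g x = b} := rfl
  rw [h, Set.ncard_preimage_of_injective_subset_range e.injective (by simp)]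

/-- An integer-valued function with sum `-1` and sum of squares `1` is `-1` at one point and
vanishes elsewhere. -/
theorem exists_eq_neg_one_of_sum_eq {ι : Type*} [Fintype ι] [DecidableEq ι] {M : ι → ℤ}
    (h₁ : ∑ i, M i = -1) (h₂ : ∑ i, M i ^ 2 = 1) : ∃ i, ∀ j, M j = if j = i then -1 else 0 := by
  obtain ⟨i, -, hi⟩ : ∃ i ∈ Finset.univ, M i ≠ 0 := by
    refine Finset.exists_ne_zero_of_sum_ne_zero (s := Finset.univ) ?_
    rw [h₁]; norm_num
  have hpos : 1 ≤ M i ^ 2 := Int.add_one_le_iff.2 (sq_pos_iff.2 hi)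
  have hzero : ∀ j, j ≠ i → M j = 0 := by
    intro j hj
    have h : M i ^ 2 + M j ^ 2 ≤ ∑ i, M i ^ 2 := by
      rw [← Finset.sum_pair (f := fun i => M i ^ 2) hj.symm]
      exact Finset.sum_le_sum_of_subset_of_nonneg (Finset.subset_univ _) fun _ _ _ => sq_nonneg _
    rw [← sq_eq_zero_iff]
    exact le_antisymm (by linarith) (sq_nonneg _)
  refine ⟨i, fun j => ?_⟩
  split_ifs with hj
  · rw [Finset.sum_eq_single i (fun j _ hj => hzero j hj) (by simp)] at h₁
    rw [hj, h₁]
  · exact hzero j hj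

variable {G : Type*} [CommGroup G] [Fintype G] {P : ℕ}

/-- The deviations of the fiber sizes from `P` are integers with sum `-1`. Counting the pairs `f x =
f y` by their quotient gives the sum of their squares as `1`, so exactly one fiber is deficient, by
one. -/
theorem existsUnique_hasBalancedFibers_sub (hG : Fintype.card G + 1 = p * P) {f : G → ZMod p}
    (hd : ∀ a : G, a ≠ 1 → HasBalancedFibers P fun x => f (a * x) - f x) :
    ∃! c : ZMod p, HasBalancedFibers P fun x => f x - c := by
  classical
  set M : ZMod p → ℤ := fun b => {x | f x = b}.ncard - P with hM
  have hN : ∑ b, ({x | f x = b}.ncard : ℤ) = p * P - 1 := by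
    have := sum_ncard_fiber f
    rw [Nat.card_eq_fintype_card] at this
    have h : ((Fintype.card G + 1 : ℕ) : ℤ) = (p * P : ℕ) := by rw [hG]
    rw [← Nat.cast_sum, this]
    push_cast at h
    linarith
  have h₁ : ∑ b, M b = -1 := by
    simp only [hM, Finset.sum_sub_distrib, hN, Finset.sum_const, Finset.card_univ, ZMod.card,
      nsmul_eq_mul]
    ring
  have hsq : ∑ b, ({x | f x = b}.ncard : ℤ) * {x | f x = b}.ncard =
      (p * P - 1) + (p * P - 2) * (P - 1) := by
    have h := sum_comp_eq_sum_ncard_mul (fun b => ({x | f x = b}.ncard : ℤ)) f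
    simp only [Int.cast_id] at h
    rw [← h, ← Nat.cast_sum, sum_ncard_fiber_eq_sum_ncard_coincidence,
      ← Finset.add_sum_erase _ _ (Finset.mem_univ 1)]
    have h1 : {y : G | f (1 * y) = f y}.ncard = Fintype.card G := by
      simp [Set.ncard_univ]
    have h2 : ∀ a ∈ Finset.univ.erase (1 : G), (({y | f (a * y) = f y}.ncard : ℕ) : ℤ) = P - 1 := by
      intro a ha
      have := hd a (Finset.ne_of_mem_erase ha) 0
      simp only [sub_eq_zero, if_true] at this
      rw [← this]
      push_cast
      ring
    rw [h1, Nat.cast_add, Nat.cast_sum, Finset.sum_congr rfl h2, Finset.sum_const,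
      Finset.card_erase_of_mem (Finset.mem_univ _), Finset.card_univ, nsmul_eq_mul,
      Nat.cast_sub Fintype.card_pos]
    have h : ((Fintype.card G + 1 : ℕ) : ℤ) = (p * P : ℕ) := by rw [hG]
    push_cast at h ⊢
    have h' : (Fintype.card G : ℤ) = p * P - 1 := by linarith
    rw [h']
    ring
  have h₂ : ∑ b, M b ^ 2 = 1 := by
    have h : ∀ b, M b ^ 2 = ({x | f x = b}.ncard : ℤ) * {x | f x = b}.ncard
        - 2 * P * {x | f x = b}.ncard + P ^ 2 := fun b => by simp only [hM]; ring
    simp only [h, Finset.sum_add_distrib, Finset.sum_sub_distrib, ← Finset.mul_sum, hN, hsq,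
      Finset.sum_const, Finset.card_univ, ZMod.card, nsmul_eq_mul]
    ring
  obtain ⟨c, hc⟩ := exists_eq_neg_one_of_sum_eq h₁ h₂
  have hset : ∀ c b : ZMod p, {x | f x - c = b} = {x | f x = b + c} := by
    intro c b
    ext x
    simp [sub_eq_iff_eq_add]
  refine ⟨c, fun b => ?_, fun c' hc' => ?_⟩
  · have h := hc (b + c)
    simp only [hM, add_eq_right] at h
    rw [hset]
    split_ifs at h ⊢ <;> omega
  · have h := hc' 0
    have h' := hc c'
    rw [hset, zero_add, if_pos rfl] at h
    by_contra hne
    simp only [hM, if_neg hne] at h'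
    omega

/-- View `(f₁, f₂)` as a map to the affine plane over `ZMod p` and sum the point counts over the `p
+ 1` lines through `(b₁, b₂)`: that point lies on all of them, every other on exactly one. The
corrected count is `P` on each line. -/
theorem ncard_pair_fiber {X : Type*} [Fintype X] (hX : Fintype.card X + 1 = p * P)
    {f₁ f₂ : X → ZMod p} (h₁ : HasBalancedFibers P f₁)
    (h₂ : ∀ t : ZMod p, HasBalancedFibers P fun x => f₂ x - t * f₁ x) (b₁ b₂ : ZMod p) :
    p * ({x | f₁ x = b₁ ∧ f₂ x = b₂}.ncard + if b₁ = 0 ∧ b₂ = 0 then 1 else 0) = P := by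
  have hpt : ∀ y₁ y₂ : ZMod p, (∑ t : ZMod p, if y₂ - t * y₁ = 0 then 1 else 0) +
      (if y₁ = 0 then 1 else 0) = 1 + p * if y₁ = 0 ∧ y₂ = 0 then 1 else 0 := by
    intro y₁ y₂
    by_cases hy : y₁ = 0
    · subst hy
      by_cases hy₂ : y₂ = 0
      · simp [hy₂, add_comm]
      · simp [hy₂]
    · have h : ∀ t, y₂ - t * y₁ = 0 ↔ t = y₂ * y₁⁻¹ := by
        intro t
        rw [sub_eq_zero, eq_mul_inv_iff_mul_eq₀ hy, eq_comm]
      simp [h, hy]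
  have hcount : ∑ t : ZMod p, {x | f₂ x - t * f₁ x = b₂ - t * b₁}.ncard + {x | f₁ x = b₁}.ncard =
      Fintype.card X + p * {x | f₁ x = b₁ ∧ f₂ x = b₂}.ncard := by
    simp only [ncard_setOf_eq_sum_ite]
    rw [Finset.sum_comm, ← Finset.sum_add_distrib, Finset.mul_sum, Fintype.card_eq_sum_ones,
      ← Finset.sum_add_distrib]
    refine Finset.sum_congr rfl fun x _ => ?_
    have h : ∀ t, f₂ x - b₂ - t * (f₁ x - b₁) = 0 ↔ f₂ x - t * f₁ x = b₂ - t * b₁ := by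
      intro t
      rw [← sub_eq_zero (b := b₂ - t * b₁)]
      ring_nf
    have h' := hpt (f₁ x - b₁) (f₂ x - b₂)
    simp only [h] at h'
    simpa only [sub_eq_zero] using h'
  have hlines : ∑ t : ZMod p, {x | f₂ x - t * f₁ x = b₂ - t * b₁}.ncard +
      ∑ t : ZMod p, (if b₂ - t * b₁ = 0 then 1 else 0) = p * P := by
    rw [← Finset.sum_add_distrib, Finset.sum_congr rfl fun t _ => h₂ t (b₂ - t * b₁)]
    simp
  have hpt' := hpt b₁ b₂
  have h₁' := h₁ b₁
  rw [mul_add]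
  omega

end Counting

/-! ### Existence of scaling elements -/

section Homogeneous

variable {p : ℕ} [hp : Fact p.Prime] {G : Type*} [CommGroup G] [Fintype G] {k : ℕ}

/-- For a normalized difference balanced function `f` and `t ≠ 0`, the function
`x ↦ f (a x) - t f x` is balanced or zero. -/
theorem hasBalancedFibers_sub_mul_or_eq (hG : Fintype.card G + 1 = p ^ (k + 1))
    {f : G → ZMod p} (hf : HasBalancedFibers (p ^ k) f)
    (hd : ∀ a : G, a ≠ 1 → HasBalancedFibers (p ^ k) fun x => f (a * x) - f x) {t : ZMod p}
    (ht : t ≠ 0) (a : G) :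
    HasBalancedFibers (p ^ k) (fun x => f (a * x) - t * f x) ∨ ∀ x, f (a * x) = t * f x := by
  have h := dvd_sum_char_sub_mul_add_one hG hf hd ht a
  rw [pow_succ'] at h hG
  refine (hasBalancedFibers_or_eq_zero (by rwa [Nat.card_eq_fintype_card]) h).imp_right fun h x => ?_
  exact sub_eq_zero.1 (h x)

theorem exists_forall_eq_mul (hG : Fintype.card G + 1 = p ^ (k + 1))
    {f : G → ZMod p} (hf : HasBalancedFibers (p ^ k) f)
    (hd : ∀ a : G, a ≠ 1 → HasBalancedFibers (p ^ k) fun x => f (a * x) - f x) {t : ZMod p}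
    (ht : t ≠ 0) : ∃ a : G, ∀ x, f (a * x) = t * f x := by
  by_contra! hne
  have hbal : ∀ a : G, {x | f (a * x) = t * f x}.ncard + 1 = p ^ k := by
    intro a
    rcases hasBalancedFibers_sub_mul_or_eq hG hf hd ht a with h | h
    · simpa [sub_eq_zero] using h 0
    · obtain ⟨x, hx⟩ := hne a
      exact absurd (h x) hx
  have h₁ := sum_ncard_fiber_eq_sum_ncard_coincidence f fun x => t * f x
  -- Counting the pairs with `f x = t * f y` by quotients loses one per element of `G`; counting by
  -- `y` in `h₃` loses one only per zero of `f`. But `f` has just `p ^ k - 1` zeros, fewer than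
  -- `|G|`.
  have h₂ : ∑ a : G, {x | f (a * x) = t * f x}.ncard + Fintype.card G = Fintype.card G * p ^ k := by
    rw [Fintype.card_eq_sum_ones, ← Finset.sum_add_distrib, Finset.sum_congr rfl fun a _ => hbal a]
    simp
  have h₃ : ∑ y, {x | f x = t * f y}.ncard + {y | f y = 0}.ncard = Fintype.card G * p ^ k := by
    rw [ncard_setOf_eq_sum_ite fun y => f y = 0, ← Finset.sum_add_distrib,
      Finset.sum_congr rfl (g := fun _ => p ^ k)]
    · simp
    · intro y _
      simpa [ht] using hf (t * f y)
  have h₄ := hf 0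
  rw [if_pos rfl] at h₄
  have h₅ : p ^ k < p ^ (k + 1) := Nat.pow_lt_pow_succ hp.out.one_lt
  omega

end Homogeneous

/-! ### The units of the prime field -/

section BaseUnits

variable (p : ℕ) [hp : Fact p.Prime] (K : Type*) [Field K] [Algebra (ZMod p) K]

theorem card_baseUnits : Nat.card (baseUnits (ZMod p) K) = p - 1 := by
  have hinj : Function.Injective (Units.map (algebraMap (ZMod p) K : ZMod p →* K)) :=
    Units.map_injective (algebraMap (ZMod p) K).injective
  rw [baseUnits, ← Nat.card_congr (MonoidHom.ofInjective hinj).toEquiv, Nat.card_eq_fintype_card,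
    ZMod.card_units]

theorem mem_baseUnits_of_pow_eq_one [Finite K] {a : Kˣ} (ha : a ^ (p - 1) = 1) :
    a ∈ baseUnits (ZMod p) K := by
  have hp1 : NeZero (p - 1) := ⟨by have := hp.out.two_le; omega⟩
  have hle : baseUnits (ZMod p) K ≤ rootsOfUnity (p - 1) K := by
    rintro _ ⟨x, rfl⟩
    rw [mem_rootsOfUnity, ← map_pow, ZMod.units_pow_card_sub_one_eq_one, map_one]
  have heq : baseUnits (ZMod p) K = rootsOfUnity (p - 1) K := by
    refine Subgroup.eq_of_le_of_card_ge hle ?_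
    rw [card_baseUnits]
    exact card_rootsOfUnity K (p - 1)
  rw [heq, mem_rootsOfUnity]
  exact ha

end BaseUnits

/-! ### Difference counts and passage to quotients -/

section DifferenceCount

variable {G : Type*} [CommGroup G]

theorem differenceCount_eq_ncard (D : Set G) {g : G} (hg : g ≠ 1) :
    differenceCount D g = {x | x ∈ D ∧ g * x ∈ D}.ncard := by
  rw [differenceCount, ← Set.ncard_image_of_injective {x | x ∈ D ∧ g * x ∈ D}
    (f := fun x => (g * x, x)) (fun x y h => (Prod.mk.inj h).2)]
  congr 1
  ext ⟨d₁, d₂⟩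
  constructor
  · rintro ⟨h₁, h₂, -, h⟩
    have h : d₁ = g * d₂ := mul_inv_eq_iff_eq_mul.1 h
    exact ⟨d₂, ⟨h₂, h ▸ h₁⟩, by rw [h]⟩
  · rintro ⟨x, ⟨h₁, h₂⟩, h⟩
    obtain ⟨rfl, rfl⟩ := Prod.mk.inj h
    exact ⟨h₂, h₁, fun h => hg (mul_eq_right.1 h), mul_inv_cancel_right _ _⟩

theorem card_mul_ncard_eq_ncard_preimage (N : Subgroup G) (S : Set (G ⧸ N)) :
    Nat.card N * S.ncard = (QuotientGroup.mk' N ⁻¹' S).ncard := by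
  exact (QuotientGroup.card_preimage_mk N S).symm

theorem card_mul_differenceCount_mk (N : Subgroup G) (S : Set (G ⧸ N)) {a : G} (ha : a ∉ N) :
    Nat.card N * differenceCount S (QuotientGroup.mk' N a) =
      {x | QuotientGroup.mk' N x ∈ S ∧ QuotientGroup.mk' N (a * x) ∈ S}.ncard := by
  have h : QuotientGroup.mk' N a ≠ 1 := by
    rw [QuotientGroup.mk'_apply, Ne, QuotientGroup.eq_one_iff]
    exact ha
  rw [differenceCount_eq_ncard S h, card_mul_ncard_eq_ncard_preimage]
  rfl

end DifferenceCount

/-! ### Autocorrelation -/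

section Autocorrelation

theorem sum_range_pow_eq_sum {G M : Type*} [Group G] [Fintype G] [AddCommMonoid M] {θ : G}
    (hθ : ∀ x : G, x ∈ Subgroup.zpowers θ) (φ : G → M) :
    ∑ i ∈ Finset.range (Fintype.card G), φ (θ ^ i) = ∑ x, φ x := by
  classical
  have ho : orderOf θ = Fintype.card G := by
    rw [orderOf_eq_card_of_forall_mem_zpowers hθ, Nat.card_eq_fintype_card]
  refine Finset.sum_bij (fun i _ => θ ^ i) (fun _ _ => Finset.mem_univ _) ?_ ?_ fun _ _ => rfl
  · intro i hi j hj h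
    rw [← ho, Finset.mem_range] at hi hj
    exact pow_injOn_Iio_orderOf hi hj h
  · intro x _
    have := mem_zpowers_iff_mem_range_orderOf.1 (hθ x)
    rw [Finset.mem_image, ho] at this
    obtain ⟨i, hi, h⟩ := this
    exact ⟨i, hi, h⟩

theorem autocorrelation_eq_sum {p : ℕ} {G : Type*} [CommGroup G] [Fintype G] {θ : G}
    (hθ : ∀ x : G, x ∈ Subgroup.zpowers θ) (ζ : ℂ) (f : G → ZMod p) (τ : ℕ) :
    autocorrelation (Fintype.card G) ζ (fun i => f (θ ^ i)) τ =
      ∑ x, ζ ^ (f (θ ^ τ * x) - f x).val := by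
  rw [autocorrelation, ← sum_range_pow_eq_sum hθ]
  simp only [pow_add, mul_comm]

/-- The shift by `τ` is multiplication by `θ ^ τ`, and every `a` is such a power. The in-phase value
is automatic; the value `-1` is balance by `hasBalancedFibers_iff_sum_pow`. -/
theorem hasIdealAutocorrelation_iff {p : ℕ} [hp : Fact p.Prime] {G : Type*} [CommGroup G]
    [Fintype G] {P : ℕ} (hG : Fintype.card G + 1 = p * P) {θ : G}
    (hθ : ∀ x : G, x ∈ Subgroup.zpowers θ) {ζ : ℂ} (hζ : IsPrimitiveRoot ζ p) (f : G → ZMod p) :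
    HasIdealAutocorrelation (Fintype.card G) ζ (fun i => f (θ ^ i)) ↔
      ∀ a : G, a ≠ 1 → HasBalancedFibers P fun x => f (a * x) - f x := by
  have ho : orderOf θ = Fintype.card G := by
    rw [orderOf_eq_card_of_forall_mem_zpowers hθ, Nat.card_eq_fintype_card]
  have hX : Nat.card G + 1 = p * P := by rwa [Nat.card_eq_fintype_card]
  simp only [hasBalancedFibers_iff_sum_pow hX hζ, HasIdealAutocorrelation,
    autocorrelation_eq_sum hθ]
  simp only [← ho, orderOf_dvd_iff_pow_eq_one]
  constructor
  · intro h a ha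
    obtain ⟨τ, rfl⟩ : ∃ τ : ℕ, θ ^ τ = a := mem_powers_iff_mem_zpowers.2 (hθ a)
    exact (h τ).2 ha
  · intro h τ
    refine ⟨fun hτ => ?_, h _⟩
    simp [hτ, ho]

end Autocorrelation

/-! ### Homogeneity over the prime field -/

section Field

theorem HasBalancedFibers.exists_eq {X F : Type*} [Zero F] [DecidableEq F] {P : ℕ} (hP : 0 < P)
    {g : X → F} (hg : HasBalancedFibers P g) {b : F} (hb : b ≠ 0) : ∃ x, g x = b := by
  have h := hg b
  rw [if_neg hb, add_zero] at h
  exact Set.nonempty_of_ncard_ne_zero (h ▸ hP.ne')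

theorem eq_one_of_forall_eq {G F : Type*} [Group G] [Field F] [DecidableEq F] {P : ℕ} (hP : 0 < P)
    {f : G → F} (hd : ∀ a : G, a ≠ 1 → HasBalancedFibers P fun x => f (a * x) - f x) {a : G}
    (ha : ∀ x, f (a * x) = f x) : a = 1 := by
  by_contra hne
  obtain ⟨x, hx⟩ := (hd a hne).exists_eq hP one_ne_zero
  rw [ha, sub_self] at hx
  exact zero_ne_one hx

/-- By Fermat, `a ^ (p - 1)` leaves `f` invariant, so it is `1` by difference balance. -/
theorem mem_baseUnits_of_forall_eq_mul {p k : ℕ} [hp : Fact p.Prime] {K : Type*} [Field K] [Finite K]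
    [Algebra (ZMod p) K] {f : Kˣ → ZMod p}
    (hd : ∀ a : Kˣ, a ≠ 1 → HasBalancedFibers (p ^ k) fun x => f (a * x) - f x) {a : Kˣ}
    {t : ZMod p} (ht : t ≠ 0) (ha : ∀ x, f (a * x) = t * f x) : a ∈ baseUnits (ZMod p) K := by
  refine mem_baseUnits_of_pow_eq_one p K (eq_one_of_forall_eq (pow_pos hp.out.pos k) hd fun x => ?_)
  have h : ∀ j : ℕ, f (a ^ j * x) = t ^ j * f x := by
    intro j
    induction j with
    | zero => simp
    | succ j ih => rw [pow_succ', mul_assoc, ha, ih, pow_succ', mul_assoc]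
  rw [h, ZMod.pow_card_sub_one_eq_one ht, one_mul]

variable {p k : ℕ} [hp : Fact p.Prime] {K : Type*} [Field K] [Fintype Kˣ] [Algebra (ZMod p) K]
  {f : Kˣ → ZMod p}

/-- A normalized difference balanced function is homogeneous for the prime field. -/
theorem exists_forall_eq_mul_of_mem_baseUnits [Finite K] (hG : Fintype.card Kˣ + 1 = p ^ (k + 1))
    (hf : HasBalancedFibers (p ^ k) f)
    (hd : ∀ a : Kˣ, a ≠ 1 → HasBalancedFibers (p ^ k) fun x => f (a * x) - f x) {a : Kˣ}
    (ha : a ∈ baseUnits (ZMod p) K) : ∃ t : ZMod p, t ≠ 0 ∧ ∀ x, f (a * x) = t * f x := by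
  have hex : ∀ t : (ZMod p)ˣ, ∃ a : baseUnits (ZMod p) K, ∀ x, f (a * x) = t * f x := by
    intro t
    obtain ⟨a, ha⟩ := exists_forall_eq_mul hG hf hd t.ne_zero
    exact ⟨⟨a, mem_baseUnits_of_forall_eq_mul hd t.ne_zero ha⟩, ha⟩
  choose A hA using hex
  have hinj : Function.Injective A := by
    intro t t' h
    obtain ⟨x, hx⟩ := hf.exists_eq (pow_pos hp.out.pos k) one_ne_zero
    have h₁ := hA t x
    rw [h, hA t' x, hx, mul_one, mul_one] at h₁
    exact Units.ext h₁.symm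
  -- There are `p - 1` scalars on either side, so each `a` in the prime field is reached by some
  -- `t`.
  have hbij : Function.Bijective A := by
    rw [Nat.bijective_iff_injective_and_card]
    refine ⟨hinj, ?_⟩
    rw [card_baseUnits, Nat.card_eq_fintype_card, ZMod.card_units]
  obtain ⟨t, ht⟩ := hbij.2 ⟨a, ha⟩
  have := hA t
  rw [ht] at this
  exact ⟨t, t.ne_zero, this⟩

theorem hasBalancedFibers_sub_mul_of_notMem_baseUnits [Finite K]
    (hG : Fintype.card Kˣ + 1 = p ^ (k + 1)) (hf : HasBalancedFibers (p ^ k) f)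
    (hd : ∀ a : Kˣ, a ≠ 1 → HasBalancedFibers (p ^ k) fun x => f (a * x) - f x) {a : Kˣ}
    (ha : a ∉ baseUnits (ZMod p) K) (t : ZMod p) :
    HasBalancedFibers (p ^ k) fun x => f (a * x) - t * f x := by
  by_cases ht : t = 0
  · simpa [ht] using hf.comp_equiv (Equiv.mulLeft a)
  · exact (hasBalancedFibers_sub_mul_or_eq hG hf hd ht a).resolve_right fun h =>
      ha (mem_baseUnits_of_forall_eq_mul hd ht h)

end Field

/-! ### Two-tuple balance and difference sets -/

section Consequences

theorem differenceCount_fiber {K F : Type*} [Field K] [Field F] (f : Kˣ → F) (b : F) {g : Kˣ} (hg : g ≠ 1) :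
    differenceCount {x | f x = b} g = pairCount f g b b := by
  rw [differenceCount_eq_ncard _ hg, pairCount]
  simp

theorem card_units_eq_mul {p k : ℕ} {K : Type*} [Field K] [Fintype Kˣ]
    (hG : Fintype.card Kˣ + 1 = p ^ (k + 1)) :
    Nat.card Kˣ = (p ^ (k + 1) - 1) / (p - 1) * (p - 1) := by
  rw [Nat.div_mul_cancel (by simpa using Nat.sub_dvd_pow_sub_pow p 1 (k + 1)),
    Nat.card_eq_fintype_card]
  omega

theorem card_quotient_baseUnits {p k : ℕ} [hp : Fact p.Prime] {K : Type*} [Field K] [Fintype Kˣ]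
    [Algebra (ZMod p) K] (hG : Fintype.card Kˣ + 1 = p ^ (k + 1)) :
    Nat.card (Kˣ ⧸ baseUnits (ZMod p) K) = (p ^ (k + 1) - 1) / (p - 1) := by
  have h := card_units_eq_mul (K := K) hG
  rw [Subgroup.card_eq_card_quotient_mul_card_subgroup (baseUnits (ZMod p) K),
    card_baseUnits] at h
  exact Nat.eq_of_mul_eq_mul_right (by have := hp.out.two_le; omega) h

variable {p k : ℕ} [hp : Fact p.Prime] {K : Type*} [Field K] [Finite K] [Fintype Kˣ]
  [Algebra (ZMod p) K] {f : Kˣ → ZMod p}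

theorem IsTwoTupleBalanced.of_hasBalancedFibers (hG : Fintype.card Kˣ + 1 = p ^ (k + 1))
    (hf : HasBalancedFibers (p ^ k) f)
    (hd : ∀ a : Kˣ, a ≠ 1 → HasBalancedFibers (p ^ k) fun x => f (a * x) - f x) :
    IsTwoTupleBalanced p (k + 1) f := by
  refine ⟨fun a ha => ?_, fun a ha => ?_⟩
  · have h := ncard_pair_fiber (by rwa [pow_succ'] at hG) hf
      (hasBalancedFibers_sub_mul_of_notMem_baseUnits hG hf hd ha)
    -- For `k = 0` the line count would say `p * N = 1`, so no `a` lies outside the prime field; the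
    -- truncated exponent `k - 1` is harmless.
    obtain ⟨j, rfl⟩ : ∃ j, k = j + 1 := by
      refine Nat.exists_eq_succ_of_ne_zero ?_
      rintro rfl
      have := h 1 1
      rw [pow_zero] at this
      exact hp.out.ne_one (Nat.eq_one_of_mul_eq_one_right this)
    have h' : ∀ b₁ b₂ : ZMod p,
        pairCount f a b₁ b₂ + (if b₁ = 0 ∧ b₂ = 0 then 1 else 0) = p ^ j := by
      intro b₁ b₂
      have := h b₁ b₂
      rw [pow_succ'] at this
      simpa only [pairCount, Prod.mk.injEq] using Nat.eq_of_mul_eq_mul_left hp.out.pos this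
    refine ⟨?_, fun b₁ b₂ hb => ?_⟩
    · have := h' 0 0
      rw [if_pos ⟨rfl, rfl⟩] at this
      exact Nat.eq_sub_of_add_eq this
    · have := h' b₁ b₂
      rwa [if_neg (by simpa using hb)] at this
  · obtain ⟨t, ht, hta⟩ := exists_forall_eq_mul_of_mem_baseUnits hG hf hd ha
    have hgraph : ∀ b, pairCount f a b (t * b) = {x | f x = b}.ncard := by
      intro b
      unfold pairCount
      congr 1
      ext x
      simp +contextual [hta]
    refine ⟨t, hta, ?_, fun b hb => ?_, fun b₁ b₂ hb => ?_⟩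
    · have h := hgraph 0
      rw [mul_zero] at h
      have h' := hf 0
      rw [if_pos rfl] at h'
      rw [h]
      exact Nat.eq_sub_of_add_eq h'
    · have h' := hf b
      rwa [if_neg hb, add_zero, ← hgraph] at h'
    · unfold pairCount
      rw [Set.ncard_eq_zero]
      ext x
      simp only [hta, Prod.mk.injEq, Set.mem_ofPred_eq, Set.mem_empty_iff_false, iff_false, not_and]
      rintro rfl h
      exact hb h.symm

theorem isRelativeDifferenceSet_fiber (hG : Fintype.card Kˣ + 1 = p ^ (k + 1))
    (hf : HasBalancedFibers (p ^ k) f)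
    (hd : ∀ a : Kˣ, a ≠ 1 → HasBalancedFibers (p ^ k) fun x => f (a * x) - f x)
    {b : ZMod p} (hb : b ≠ 0) :
    IsRelativeDifferenceSet (baseUnits (ZMod p) K) ((p ^ (k + 1) - 1) / (p - 1)) (p - 1) (p ^ k)
      (p ^ (k - 1)) {x : Kˣ | f x = b} := by
  have h2 := IsTwoTupleBalanced.of_hasBalancedFibers hG hf hd
  refine ⟨card_units_eq_mul hG, card_baseUnits p K, ?_, fun g hg hg1 => ?_, fun g hg => ?_⟩
  · have := hf b
    rwa [if_neg hb, add_zero] at this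
  · rw [differenceCount_fiber f b hg1]
    obtain ⟨μ, hμ, -, -, h⟩ := h2.2 g hg
    refine h b b fun h => hg1 (eq_one_of_forall_eq (pow_pos hp.out.pos k) hd fun x => ?_)
    have : μ = 1 := mul_right_cancel₀ hb (by rw [one_mul, ← h])
    rw [hμ, this, one_mul]
  · have hg1 : g ≠ 1 := fun h => hg (h ▸ one_mem _)
    rw [differenceCount_fiber f b hg1]
    exact (h2.1 g hg).2 b b (by simp [hb])

theorem isDivisibleDifferenceSet_fiber_zero (hG : Fintype.card Kˣ + 1 = p ^ (k + 1))
    (hf : HasBalancedFibers (p ^ k) f)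
    (hd : ∀ a : Kˣ, a ≠ 1 → HasBalancedFibers (p ^ k) fun x => f (a * x) - f x) :
    IsDivisibleDifferenceSet (baseUnits (ZMod p) K) ((p ^ (k + 1) - 1) / (p - 1)) (p - 1)
      (p ^ k - 1) (p ^ k - 1) (p ^ (k - 1) - 1) {x : Kˣ | f x = 0} := by
  have h2 := IsTwoTupleBalanced.of_hasBalancedFibers hG hf hd
  refine ⟨card_units_eq_mul hG, card_baseUnits p K, ?_, fun g hg hg1 => ?_, fun g hg => ?_⟩
  · have := hf 0
    rw [if_pos rfl] at this
    exact Nat.eq_sub_of_add_eq this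
  · rw [differenceCount_fiber f 0 hg1]
    obtain ⟨μ, -, h, -⟩ := h2.2 g hg
    exact h
  · have hg1 : g ≠ 1 := fun h => hg (h ▸ one_mem _)
    rw [differenceCount_fiber f 0 hg1]
    exact (h2.1 g hg).1

theorem preimage_image_mk_fiber_zero (hG : Fintype.card Kˣ + 1 = p ^ (k + 1))
    (hf : HasBalancedFibers (p ^ k) f)
    (hd : ∀ a : Kˣ, a ≠ 1 → HasBalancedFibers (p ^ k) fun x => f (a * x) - f x) (x : Kˣ) :
    QuotientGroup.mk' (baseUnits (ZMod p) K) x ∈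
      QuotientGroup.mk' (baseUnits (ZMod p) K) '' {x : Kˣ | f x = 0} ↔ f x = 0 := by
  refine ⟨?_, fun h => ⟨x, h, rfl⟩⟩
  rintro ⟨y, hy, hyx⟩
  obtain ⟨a, ha, rfl⟩ := (QuotientGroup.mk'_eq_mk' _).1 hyx
  obtain ⟨t, -, h⟩ := exists_forall_eq_mul_of_mem_baseUnits hG hf hd ha
  have hy : f y = 0 := hy
  rw [mul_comm, h, hy, mul_zero]

/-- Scalars permute the nonzero values of `f` transitively, so every coset on which `f` is nonzero
meets each nonzero fiber. -/
theorem preimage_image_mk_fiber (hG : Fintype.card Kˣ + 1 = p ^ (k + 1))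
    (hf : HasBalancedFibers (p ^ k) f)
    (hd : ∀ a : Kˣ, a ≠ 1 → HasBalancedFibers (p ^ k) fun x => f (a * x) - f x)
    {b : ZMod p} (hb : b ≠ 0) (x : Kˣ) :
    QuotientGroup.mk' (baseUnits (ZMod p) K) x ∈
      QuotientGroup.mk' (baseUnits (ZMod p) K) '' {x : Kˣ | f x = b} ↔ f x ≠ 0 := by
  constructor
  · rintro ⟨y, hy, hyx⟩
    obtain ⟨a, ha, rfl⟩ := (QuotientGroup.mk'_eq_mk' _).1 hyx
    obtain ⟨t, ht, h⟩ := exists_forall_eq_mul_of_mem_baseUnits hG hf hd ha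
    have hy : f y = b := hy
    rw [mul_comm, h, hy]
    exact mul_ne_zero ht hb
  · intro hx
    have ht : b * (f x)⁻¹ ≠ 0 := mul_ne_zero hb (inv_ne_zero hx)
    obtain ⟨a, ha⟩ := exists_forall_eq_mul hG hf hd ht
    refine ⟨a * x, ?_, ?_⟩
    · change f (a * x) = b
      rw [ha, inv_mul_cancel_right₀ hx]
    · refine ((QuotientGroup.mk'_eq_mk' _).2 ⟨a, ?_, mul_comm x a⟩).symm
      exact mem_baseUnits_of_forall_eq_mul hd ht ha

theorem isDifferenceSet_image_mk_fiber_zero (hG : Fintype.card Kˣ + 1 = p ^ (k + 1))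
    (hf : HasBalancedFibers (p ^ k) f)
    (hd : ∀ a : Kˣ, a ≠ 1 → HasBalancedFibers (p ^ k) fun x => f (a * x) - f x) :
    IsDifferenceSet ((p ^ (k + 1) - 1) / (p - 1)) ((p ^ k - 1) / (p - 1))
      ((p ^ (k - 1) - 1) / (p - 1))
      (QuotientGroup.mk' (baseUnits (ZMod p) K) '' {x : Kˣ | f x = 0}) := by
  have hp1 : 0 < p - 1 := by have := hp.out.two_le; omega
  have hmem := preimage_image_mk_fiber_zero hG hf hd
  refine ⟨card_quotient_baseUnits hG, ?_, fun g hg => ?_⟩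
  · refine Nat.eq_div_of_mul_eq_right hp1.ne' ?_
    rw [← card_baseUnits p K, card_mul_ncard_eq_ncard_preimage]
    simp only [Set.preimage, hmem]
    exact (isDivisibleDifferenceSet_fiber_zero hG hf hd).card_set
  · obtain ⟨a, rfl⟩ := QuotientGroup.mk'_surjective _ g
    have ha : a ∉ baseUnits (ZMod p) K := by
      rwa [QuotientGroup.mk'_apply, Ne, QuotientGroup.eq_one_iff] at hg
    refine Nat.eq_div_of_mul_eq_right hp1.ne' ?_
    rw [← card_baseUnits p K, card_mul_differenceCount_mk _ _ ha]
    simp only [hmem]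
    have h := ((IsTwoTupleBalanced.of_hasBalancedFibers hG hf hd).1 a ha).1
    simp only [pairCount, Prod.mk.injEq] at h
    exact h

theorem isDifferenceSet_image_mk_fiber (hG : Fintype.card Kˣ + 1 = p ^ (k + 1))
    (hf : HasBalancedFibers (p ^ k) f)
    (hd : ∀ a : Kˣ, a ≠ 1 → HasBalancedFibers (p ^ k) fun x => f (a * x) - f x)
    {b : ZMod p} (hb : b ≠ 0) :
    IsDifferenceSet ((p ^ (k + 1) - 1) / (p - 1)) (p ^ k) (p ^ (k - 1) * (p - 1))
      (QuotientGroup.mk' (baseUnits (ZMod p) K) '' {x : Kˣ | f x = b}) := by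
  have hp1 : 0 < p - 1 := by have := hp.out.two_le; omega
  have hmem := preimage_image_mk_fiber hG hf hd hb
  have hcard : (Finset.univ.erase (0 : ZMod p)).card = p - 1 := by
    rw [Finset.card_erase_of_mem (Finset.mem_univ _), Finset.card_univ, ZMod.card]
  refine ⟨card_quotient_baseUnits hG, ?_, fun g hg => ?_⟩
  · refine Nat.eq_of_mul_eq_mul_left hp1 ?_
    rw [← card_baseUnits p K, card_mul_ncard_eq_ncard_preimage, card_baseUnits]
    simp only [Set.preimage, hmem]
    have h : {x : Kˣ | f x ≠ 0}.ncard =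
        ∑ b ∈ Finset.univ.erase (0 : ZMod p), {x : Kˣ | f x = b}.ncard := by
      simp only [ncard_setOf_eq_sum_ite]
      rw [Finset.sum_comm]
      refine Finset.sum_congr rfl fun x _ => ?_
      simp
    have h' : ∀ b ∈ Finset.univ.erase (0 : ZMod p), {x : Kˣ | f x = b}.ncard = p ^ k := by
      intro b hb
      have := hf b
      rwa [if_neg (Finset.ne_of_mem_erase hb), add_zero] at this
    rw [h, Finset.sum_congr rfl h', Finset.sum_const, hcard, smul_eq_mul]
  · obtain ⟨a, rfl⟩ := QuotientGroup.mk'_surjective _ g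
    have ha : a ∉ baseUnits (ZMod p) K := by
      rwa [QuotientGroup.mk'_apply, Ne, QuotientGroup.eq_one_iff] at hg
    refine Nat.eq_of_mul_eq_mul_left hp1 ?_
    rw [← card_baseUnits p K, card_mul_differenceCount_mk _ _ ha, card_baseUnits]
    simp only [hmem]
    have h : {x : Kˣ | f x ≠ 0 ∧ f (a * x) ≠ 0}.ncard =
        ∑ b₁ ∈ Finset.univ.erase (0 : ZMod p), ∑ b₂ ∈ Finset.univ.erase (0 : ZMod p),
          pairCount f a b₁ b₂ := by
      simp only [pairCount, ncard_setOf_eq_sum_ite]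
      rw [Finset.sum_congr rfl fun b₁ _ => Finset.sum_comm, Finset.sum_comm]
      refine Finset.sum_congr rfl fun x _ => ?_
      simp only [Prod.mk.injEq, ite_and, Finset.sum_ite_irrel, Finset.sum_const_zero,
        Finset.sum_ite_eq]
      simp
    have h' : ∀ b₁ ∈ Finset.univ.erase (0 : ZMod p), ∀ b₂ ∈ Finset.univ.erase (0 : ZMod p),
        pairCount f a b₁ b₂ = p ^ (k - 1) := by
      intro b₁ hb₁ b₂ _
      refine ((IsTwoTupleBalanced.of_hasBalancedFibers hG hf hd).1 a ha).2 b₁ b₂ ?_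
      simp [Finset.ne_of_mem_erase hb₁]
    rw [h, Finset.sum_congr rfl fun b₁ hb₁ => Finset.sum_congr rfl (h' b₁ hb₁)]
    simp only [Finset.sum_const, hcard, smul_eq_mul]
    ring

end Consequences

theorem corollary5p4 (p n : ℕ) [Fact p.Prime] (K : Type*) [Field K] [Finite K]
    [Algebra (ZMod p) K] (hK : Nat.card K = p ^ n) (f : Kˣ → ZMod p) :
    -- difference balance is equivalent to ideal two-level autocorrelation
    (∀ (θ : Kˣ) (ζ : ℂ), (∀ x : Kˣ, x ∈ Subgroup.zpowers θ) → IsPrimitiveRoot ζ p →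
      (IsDifferenceBalanced p n f ↔
        HasIdealAutocorrelation (p ^ n - 1) ζ (fun i => f (θ ^ i)))) ∧
    (IsDifferenceBalanced p n f →
      -- exactly one translate of `f` is balanced, so that the normalization below is no loss
      (∃! c : ZMod p, IsBalanced p n (fun x => f x - c)) ∧
      -- the normalization: `f` has one zero less than it has preimages of other values
      ({x : Kˣ | f x = 0}.ncard = p ^ (n - 1) - 1 →
        IsTwoTupleBalanced p n f ∧
        IsCyclic Kˣ ∧
        (∀ b : ZMod p, b ≠ 0 →
          IsRelativeDifferenceSet (baseUnits (ZMod p) K)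
            ((p ^ n - 1) / (p - 1)) (p - 1) (p ^ (n - 1)) (p ^ (n - 2)) {x : Kˣ | f x = b}) ∧
        IsDivisibleDifferenceSet (baseUnits (ZMod p) K)
          ((p ^ n - 1) / (p - 1)) (p - 1) (p ^ (n - 1) - 1) (p ^ (n - 1) - 1) (p ^ (n - 2) - 1)
          {x : Kˣ | f x = 0} ∧
        IsCyclic (Kˣ ⧸ baseUnits (ZMod p) K) ∧
        (∀ b : ZMod p, b ≠ 0 →
          IsDifferenceSet ((p ^ n - 1) / (p - 1)) (p ^ (n - 1)) (p ^ (n - 2) * (p - 1))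
            (QuotientGroup.mk' (baseUnits (ZMod p) K) '' {x : Kˣ | f x = b}) ∧
          QuotientGroup.mk' (baseUnits (ZMod p) K) '' {x : Kˣ | f x = 0} =
            (QuotientGroup.mk' (baseUnits (ZMod p) K) '' {x : Kˣ | f x = b})ᶜ) ∧
        IsDifferenceSet ((p ^ n - 1) / (p - 1)) ((p ^ (n - 1) - 1) / (p - 1))
          ((p ^ (n - 2) - 1) / (p - 1))
          (QuotientGroup.mk' (baseUnits (ZMod p) K) '' {x : Kˣ | f x = 0}))) := by
  have hp : Fact p.Prime := inferInstance
  have := Fintype.ofFinite Kˣ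
  obtain ⟨k, rfl⟩ : ∃ k, n = k + 1 := by
    refine Nat.exists_eq_succ_of_ne_zero ?_
    rintro rfl
    exact (Finite.one_lt_card (α := K)).ne' hK
  have hG' : Fintype.card Kˣ = p ^ (k + 1) - 1 := by
    rw [← Nat.card_eq_fintype_card, Nat.card_units, hK]
  have hG : Fintype.card Kˣ + 1 = p ^ (k + 1) := by
    rw [hG', Nat.sub_add_cancel (Nat.one_le_pow _ _ hp.out.pos)]
  have hG₂ : Fintype.card Kˣ + 1 = p * p ^ k := by rw [hG, pow_succ']
  have hp0 : 0 < p := hp.out.pos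
  have hbal : IsDifferenceBalanced p (k + 1) f ↔
      ∀ a : Kˣ, a ≠ 1 → HasBalancedFibers (p ^ k) fun x => f (a * x) - f x := by
    simp only [IsDifferenceBalanced, isBalanced_iff_hasBalancedFibers hp0, Nat.add_sub_cancel]
  rw [hbal]
  refine ⟨fun θ ζ hθ hζ => ?_, fun hd => ⟨?_, fun h₀ => ?_⟩⟩
  · rw [← hG']
    exact (hasIdealAutocorrelation_iff hG₂ hθ hζ f).symm
  · simp only [isBalanced_iff_hasBalancedFibers hp0, Nat.add_sub_cancel]
    exact existsUnique_hasBalancedFibers_sub hG₂ hd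
  · have hf : HasBalancedFibers (p ^ k) f := by
      -- The number of zeros alone locates the deficient fiber: if `c ≠ 0`, then `f` would have `p ^
      -- k` zeros.
      obtain ⟨c, hc, -⟩ := existsUnique_hasBalancedFibers_sub hG₂ hd
      have hc0 : c = 0 := by
        by_contra hne
        have h := hc (-c)
        rw [if_neg (neg_ne_zero.2 hne)] at h
        simp only [sub_eq_neg_self, h₀, Nat.add_sub_cancel] at h
        have := Nat.one_le_pow k p hp0
        omega
      simpa [hc0] using hc
    refine ⟨.of_hasBalancedFibers hG hf hd, inferInstance,
      fun b hb => isRelativeDifferenceSet_fiber hG hf hd hb,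
      isDivisibleDifferenceSet_fiber_zero hG hf hd, inferInstance,
      fun b hb => ⟨isDifferenceSet_image_mk_fiber hG hf hd hb, ?_⟩,
      isDifferenceSet_image_mk_fiber_zero hG hf hd⟩
    ext y
    obtain ⟨x, rfl⟩ := QuotientGroup.mk'_surjective _ y
    rw [Set.mem_compl_iff, preimage_image_mk_fiber_zero hG hf hd,
      preimage_image_mk_fiber hG hf hd hb, not_not]
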